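/- Let $\Omega=(-1,1)^2\setminus[-1,0]^2\subset\mathbb R^2$ be the L-shaped domain, covered by the two overlapping open rectangles $\Omega_1=(-1,1)\times(0,1)$ and $\Omega_2=(0,1)\times(-1,1)$, so that $\Omega=\Omega_1\cup\Omega_2$. Let $H=H^1_0(\Omega)$ be the real Hilbert space with the norm $\|v\|_H=\left(\int_\Omega|\nabla v|^2\,dx\right)^{1/2}$, and regard $H_i=H^1_0(\Omega_i)$, $i=1,2$, as closed subspaces of $H$ through extension by zero. Then for every $v\in H$ the minimum $$\min\left\{\sqrt{\|v_1\|_H^2+\|v_2\|_H^2}\;:\; v_1\in H_1,\ v_2\in H_2,\ v=v_1+v_2\right\}$$ exists (in particular every $v\in H$ has such a decomposition), and the decomposition constant $$\xi(\{H_1,H_2\}):=\sup_{v\in H\setminus\{0\}}\frac{1}{\|v\|_H}\min\left\{\sqrt{\|v_1\|_H^2+\|v_2\|_H^2}\;:\; v_1\in H_1,\ v_2\in H_2,\ v=v_1+v_2\right\}$$ satisfies $\xi(\{H_1,H_2\})\le\sqrt2$. -/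

import Mathlib

open MeasureTheory
open scoped ENNReal ContDiff

noncomputable section

/-! ## The decomposition constant of a family of closed subspaces -/

/-- The set of values `√(∑ i, ‖v_i‖²)` over all decompositions `v = ∑ i, v_i` with `v_i ∈ V i`. -/
def decompositionCosts {H ι : Type*} [NormedAddCommGroup H] [InnerProductSpace ℝ H] [Fintype ι]
    (V : ι → Submodule ℝ H) (v : H) : Set ℝ :=
  {r | ∃ w : ι → H, (∀ i, w i ∈ V i) ∧ v = ∑ i, w i ∧ r = √(∑ i, ‖w i‖ ^ 2)}

/-- `ξ(V) = sup_{v ≠ 0} ‖v‖⁻¹ inf {√(∑ i, ‖v_i‖²) : v_i ∈ V i, v = ∑ i, v_i}` as an extended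
nonnegative real: it is `∞` if some `v` has no decomposition at all. -/
def decompositionConstant {H ι : Type*} [NormedAddCommGroup H] [InnerProductSpace ℝ H]
    [CompleteSpace H] [Fintype ι] (V : ι → Submodule ℝ H) : ℝ≥0∞ :=
  ⨆ (v : H) (_ : v ≠ 0), (⨅ r ∈ decompositionCosts V v, ENNReal.ofReal r) / ENNReal.ofReal ‖v‖

/-! ## Sobolev spaces on subsets of the plane -/

/-- The plane with its Euclidean norm. -/
abbrev Plane : Type := EuclideanSpace ℝ (Fin 2)

/-- `φ ∈ C_c^∞(U)`. -/
def IsTestFunction (U : Set Plane) (φ : Plane → ℝ) : Prop :=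
  ContDiff ℝ ∞ φ ∧ HasCompactSupport φ ∧ tsupport φ ⊆ U

/-- `L²(Ω) × L²(Ω; ℝ²)` with the norm `(‖u‖² + ‖g‖²)^{1/2}`. -/
abbrev L2Pair (Ω : Set Plane) : Type :=
  WithLp 2 (Lp ℝ 2 (volume.restrict Ω) × Lp Plane 2 (volume.restrict Ω))

/-- `g` is the weak gradient of `u` on `Ω`: `∫_Ω u ∇φ = - ∫_Ω φ g` for all `φ ∈ C_c^∞(Ω)`. -/
def IsWeakGradient (Ω : Set Plane) (u : Plane → ℝ) (g : Plane → Plane) : Prop :=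
  ∀ φ : Plane → ℝ, IsTestFunction Ω φ →
    ∫ x in Ω, u x • gradient φ x = - ∫ x in Ω, φ x • g x

theorem IsTestFunction.memLp {U : Set Plane} {φ : Plane → ℝ} (h : IsTestFunction U φ)
    (μ : Measure Plane) [IsFiniteMeasureOnCompacts μ] : MemLp φ 2 μ :=
  h.1.continuous.memLp_of_hasCompactSupport h.2.1

theorem gradient_eq_comp (φ : Plane → ℝ) :
    gradient φ = fun x => (InnerProductSpace.toDual ℝ Plane).symm (fderiv ℝ φ x) := rfl

theorem IsTestFunction.memLp_gradient {U : Set Plane} {φ : Plane → ℝ} (h : IsTestFunction U φ)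
    (μ : Measure Plane) [IsFiniteMeasureOnCompacts μ] : MemLp (gradient φ) 2 μ := by
  rw [gradient_eq_comp]
  refine Continuous.memLp_of_hasCompactSupport ?_ ?_
  · exact (LinearIsometryEquiv.continuous _).comp (h.1.continuous_fderiv (by simp))
  · exact (h.2.1.fderiv ℝ).comp_left (map_zero _)

theorem IsWeakGradient.add {Ω : Set Plane} {u v : Plane → ℝ} {g k : Plane → Plane}
    (hu : MemLp u 2 (volume.restrict Ω)) (hv : MemLp v 2 (volume.restrict Ω))
    (hg : MemLp g 2 (volume.restrict Ω)) (hk : MemLp k 2 (volume.restrict Ω))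
    (h₁ : IsWeakGradient Ω u g) (h₂ : IsWeakGradient Ω v k) :
    IsWeakGradient Ω (u + v) (g + k) := by
  intro φ hφ
  have a := hφ.memLp (volume.restrict Ω)
  have b := hφ.memLp_gradient (volume.restrict Ω)
  have i₁ : Integrable (fun x => u x • gradient φ x) (volume.restrict Ω) :=
    memLp_one_iff_integrable.1 (b.smul hu)
  have i₂ : Integrable (fun x => v x • gradient φ x) (volume.restrict Ω) :=
    memLp_one_iff_integrable.1 (b.smul hv)
  have i₃ : Integrable (fun x => φ x • g x) (volume.restrict Ω) :=
    memLp_one_iff_integrable.1 (hg.smul a)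
  have i₄ : Integrable (fun x => φ x • k x) (volume.restrict Ω) :=
    memLp_one_iff_integrable.1 (hk.smul a)
  simp only [Pi.add_apply, add_smul, smul_add]
  rw [integral_add i₁ i₂, integral_add i₃ i₄, h₁ φ hφ, h₂ φ hφ, neg_add]

theorem IsWeakGradient.smul {Ω : Set Plane} {u : Plane → ℝ} {g : Plane → Plane}
    (c : ℝ) (h : IsWeakGradient Ω u g) : IsWeakGradient Ω (c • u) (c • g) := by
  intro φ hφ
  have h' := h φ hφ
  simp only [Pi.smul_apply, smul_assoc]
  rw [integral_smul, h']
  simp only [smul_comm _ c]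
  rw [integral_smul, smul_neg]

theorem IsWeakGradient.congr {Ω : Set Plane} {u v : Plane → ℝ} {g k : Plane → Plane}
    (h : IsWeakGradient Ω u g) (huv : u =ᵐ[volume.restrict Ω] v)
    (hgk : g =ᵐ[volume.restrict Ω] k) : IsWeakGradient Ω v k := by
  intro φ hφ
  have h' := h φ hφ
  rw [integral_congr_ae (g := fun x => v x • gradient φ x)
      (by filter_upwards [huv] with x hx using by rw [hx]),
    integral_congr_ae (f := fun x => φ x • g x) (g := fun x => φ x • k x)
      (by filter_upwards [hgk] with x hx using by rw [hx])] at h'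
  exact h'

/-- The Sobolev space `H¹(Ω)`: an element is an `L²` function together with its (unique) weak
gradient in `L²`; the norm inherited from `L2Pair Ω` is the usual `H¹` norm. -/
def H1 (Ω : Set Plane) : Submodule ℝ (L2Pair Ω) where
  carrier := {w | IsWeakGradient Ω w.fst w.snd}
  zero_mem' := by
    have : IsWeakGradient Ω 0 0 := fun φ _ => by simp
    exact this.congr (Lp.coeFn_zero _ _ _).symm (Lp.coeFn_zero _ _ _).symm
  add_mem' := by
    intro a b ha hb
    exact (IsWeakGradient.add (Lp.memLp _) (Lp.memLp _) (Lp.memLp _) (Lp.memLp _) ha hb).congr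
      (Lp.coeFn_add _ _).symm (Lp.coeFn_add _ _).symm
  smul_mem' := by
    intro c a ha
    exact (IsWeakGradient.smul c ha).congr (Lp.coeFn_smul _ _).symm (Lp.coeFn_smul _ _).symm

/-- `C_c^∞(U)` as a subspace of `H¹(Ω)`, for `U ⊆ Ω`. -/
def testSubspace (Ω U : Set Plane) : Submodule ℝ (H1 Ω) where
  carrier := {w | ∃ φ : Plane → ℝ, IsTestFunction U φ ∧
    w.1.fst =ᵐ[volume.restrict Ω] φ ∧ w.1.snd =ᵐ[volume.restrict Ω] gradient φ}
  zero_mem' := by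
    refine ⟨0, ⟨contDiff_const, HasCompactSupport.zero, by simp [tsupport]⟩,
      Lp.coeFn_zero _ _ _, ?_⟩
    refine (Lp.coeFn_zero _ _ _).trans (Filter.Eventually.of_forall fun x => ?_)
    simp [gradient]
  add_mem' := by
    rintro a b ⟨φ, hφ, h₁, h₂⟩ ⟨ψ, hψ, k₁, k₂⟩
    refine ⟨φ + ψ, ⟨hφ.1.add hψ.1, hφ.2.1.add hψ.2.1,
      (tsupport_add φ ψ).trans (Set.union_subset hφ.2.2 hψ.2.2)⟩,
      (Lp.coeFn_add _ _).trans (h₁.add k₁), (Lp.coeFn_add _ _).trans ((h₂.add k₂).trans ?_)⟩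
    refine Filter.Eventually.of_forall fun x => ?_
    simp only [gradient, Pi.add_apply]
    rw [fderiv_add (hφ.1.differentiable (by simp) x) (hψ.1.differentiable (by simp) x), map_add]
  smul_mem' := by
    rintro c a ⟨φ, hφ, h₁, h₂⟩
    refine ⟨c • φ, ⟨contDiff_const.smul hφ.1, hφ.2.1.smul_left (f := fun _ => c), ?_⟩,
      (Lp.coeFn_smul _ _).trans (h₁.const_smul c),
      (Lp.coeFn_smul _ _).trans ((h₂.const_smul c).trans ?_)⟩
    · exact (tsupport_smul_subset_right (fun _ => c) φ).trans hφ.2.2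
    · refine Filter.Eventually.of_forall fun x => ?_
      simp only [gradient, Pi.smul_apply]
      rw [fderiv_const_smul (hφ.1.differentiable (by simp) x), map_smul]

/-- The closure of `C_c^∞(U)` in `H¹(Ω)`. For `U = Ω` this is `H¹₀(Ω)`; for an open `U ⊆ Ω` it
is `H¹₀(U)`, each function being extended by zero to `Ω`. -/
def H10In (Ω U : Set Plane) : Submodule ℝ (H1 Ω) := (testSubspace Ω U).topologicalClosure

/-! ## `H¹₀(Ω)` as a Hilbert space for the Dirichlet inner product -/

theorem poincare (Ω : Set Plane) (hΩ : Bornology.IsBounded Ω) :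
    ∃ C : ℝ, 0 ≤ C ∧ ∀ w ∈ H10In Ω Ω, ‖w.1.fst‖ ≤ C * ‖w.1.snd‖ := by
  set K : ℝ≥0∞ := (eLpNormLESNormFDerivOfLeConst ℝ (volume : Measure Plane) Ω 1 2 : ℝ≥0∞) *
    (volume Ω) ^ ((1 : ℝ) / 2) with hK
  have hKtop : K ≠ ⊤ := ENNReal.mul_ne_top ENNReal.coe_ne_top
    (ENNReal.rpow_ne_top_of_nonneg (by norm_num) hΩ.measure_lt_top.ne)
  refine ⟨K.toReal, ENNReal.toReal_nonneg, fun w hw => ?_⟩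
  have hcl : IsClosed {w : H1 Ω | ‖w.1.fst‖ ≤ K.toReal * ‖w.1.snd‖} :=
    isClosed_le (by fun_prop) (by fun_prop)
  refine closure_minimal (s := (testSubspace Ω Ω : Set (H1 Ω))) ?_ hcl hw
  rintro w ⟨φ, hφ, h₁, h₂⟩
  have hsupp : Function.support φ ⊆ Ω := (subset_tsupport φ).trans hφ.2.2
  have hsupp' : Function.support (fderiv ℝ φ) ⊆ Ω := (support_fderiv_subset ℝ).trans hφ.2.2
  have key : eLpNorm w.1.fst 2 (volume.restrict Ω) ≤
      K * eLpNorm w.1.snd 2 (volume.restrict Ω) := by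
    have hgrad : eLpNorm (fderiv ℝ φ) 2 (volume.restrict Ω) =
        eLpNorm w.1.snd 2 (volume.restrict Ω) := by
      rw [eLpNorm_congr_ae h₂]
      refine eLpNorm_congr_norm_ae (Filter.Eventually.of_forall fun x => ?_)
      simp [gradient]
    rw [eLpNorm_congr_ae h₁, eLpNorm_restrict_eq_of_support_subset hsupp]
    refine (eLpNorm_le_eLpNorm_fderiv_of_le (volume : Measure Plane) (p := 1) (q := 2)
      (hφ.1.of_le (by simp)) hsupp le_rfl (by simp) (by simp; norm_num) hΩ).trans ?_
    rw [hK, mul_assoc]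
    refine mul_le_mul_right ?_ _
    have hr : eLpNorm (fderiv ℝ φ) 1 (volume.restrict Ω) = eLpNorm (fderiv ℝ φ) 1 volume :=
      eLpNorm_restrict_eq_of_support_subset (ε := Plane →L[ℝ] ℝ) hsupp'
    rw [← hgrad, ENNReal.coe_one, ← hr, mul_comm]
    refine (eLpNorm_le_eLpNorm_mul_rpow_measure_univ (q := 2) (by simp)
      (hφ.1.continuous_fderiv (by simp)).aestronglyMeasurable).trans (le_of_eq ?_)
    norm_num
  simp only [Set.mem_ofPred_eq, Lp.norm_def]
  rw [← ENNReal.toReal_mul]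
  exact ENNReal.toReal_mono (ENNReal.mul_ne_top hKtop (Lp.eLpNorm_ne_top _)) key

theorem isClosed_H1 (Ω : Set Plane) : IsClosed (H1 Ω : Set (L2Pair Ω)) := by
  have : (H1 Ω : Set (L2Pair Ω)) = ⋂ (φ : Plane → ℝ) (_ : IsTestFunction Ω φ),
      {w : L2Pair Ω | ∫ x in Ω, w.fst x • gradient φ x = - ∫ x in Ω, φ x • w.snd x} := by
    ext w; simp [H1, IsWeakGradient]
  rw [this]
  refine isClosed_iInter fun φ => isClosed_iInter fun hφ => ?_
  have a := hφ.memLp (volume.restrict Ω)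
  have b := hφ.memLp_gradient (volume.restrict Ω)
  let B : ℝ →L[ℝ] Plane →L[ℝ] Plane := ContinuousLinearMap.lsmul ℝ ℝ
  have e₁ : ∀ w : L2Pair Ω, ∫ x in Ω, w.fst x • gradient φ x =
      B.lpPairing (volume.restrict Ω) 2 2 w.fst (b.toLp _) := fun w => by
    rw [ContinuousLinearMap.lpPairing_eq_integral]
    refine integral_congr_ae ?_
    filter_upwards [b.coeFn_toLp] with x hx
    simp [B, hx]
  have e₂ : ∀ w : L2Pair Ω, ∫ x in Ω, φ x • w.snd x =
      B.lpPairing (volume.restrict Ω) 2 2 (a.toLp _) w.snd := fun w => by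
    rw [ContinuousLinearMap.lpPairing_eq_integral]
    refine integral_congr_ae ?_
    filter_upwards [a.coeFn_toLp] with x hx
    simp [B, hx]
  simp only [e₁, e₂]
  exact isClosed_eq (by fun_prop) (by fun_prop)

/-- The space `H¹₀(Ω)`, to be equipped with the norm `(∫_Ω |∇v|²)^{1/2}`. -/
def H10 (Ω : Set Plane) : Type := H10In Ω Ω

namespace H10

variable {Ω : Set Plane}

instance : AddCommGroup (H10 Ω) := inferInstanceAs (AddCommGroup (H10In Ω Ω))

instance : Module ℝ (H10 Ω) := inferInstanceAs (Module ℝ (H10In Ω Ω))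

/-- The inclusion of `H¹₀(Ω)` in `H¹(Ω)`. -/
def toH1 : H10 Ω →ₗ[ℝ] H1 Ω := (H10In Ω Ω).subtype

/-- The weak gradient, as an element of `L²(Ω; ℝ²)`. -/
def grad : H10 Ω →ₗ[ℝ] Lp Plane 2 (volume.restrict Ω) where
  toFun v := (toH1 v).1.snd
  map_add' _ _ := rfl
  map_smul' _ _ := rfl

theorem grad_injective [hΩ : Fact (Bornology.IsBounded Ω)] :
    Function.Injective (grad : H10 Ω → Lp Plane 2 (volume.restrict Ω)) := by
  obtain ⟨C, -, hC⟩ := poincare Ω hΩ.out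
  refine (injective_iff_map_eq_zero grad).2 fun v hv => ?_
  have hv₂ : (toH1 v).1.snd = 0 := hv
  have hv₁ : (toH1 v).1.fst = 0 := by
    have := hC (toH1 v) v.2
    rw [hv₂, norm_zero, mul_zero] at this
    exact norm_le_zero_iff.1 this
  have h : (toH1 v).1 = 0 := (WithLp.ext_iff 2).2 (Prod.ext hv₁ hv₂)
  exact Subtype.ext (Subtype.ext h)

instance [Fact (Bornology.IsBounded Ω)] : NormedAddCommGroup (H10 Ω) :=
  NormedAddCommGroup.induced _ _ grad grad_injective

/-- The Dirichlet inner product `∫_Ω ∇u · ∇v`. -/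
instance [Fact (Bornology.IsBounded Ω)] : InnerProductSpace ℝ (H10 Ω) where
  norm_smul_le c v := by
    change ‖grad (c • v)‖ ≤ ‖c‖ * ‖grad v‖
    rw [map_smul]; exact norm_smul_le _ _
  inner u v := inner ℝ (grad u) (grad v)
  norm_sq_eq_re_inner v := norm_sq_eq_re_inner (𝕜 := ℝ) (grad v)
  conj_inner_symm u v := inner_conj_symm (𝕜 := ℝ) (grad u) (grad v)
  add_left u v w := by
    change inner ℝ (grad (u + v)) (grad w) = _
    rw [map_add]; exact inner_add_left _ _ _
  smul_left u v c := by
    change inner ℝ (grad (c • u)) (grad v) = _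
    rw [map_smul]; exact inner_smul_left _ _ _

instance [hΩ : Fact (Bornology.IsBounded Ω)] : CompleteSpace (H10 Ω) := by
  obtain ⟨C, hC0, hC⟩ := poincare Ω hΩ.out
  have : CompleteSpace (H1 Ω) := (isClosed_H1 Ω).completeSpace_coe
  have : CompleteSpace (H10In Ω Ω) :=
    (Submodule.isClosed_topologicalClosure (testSubspace Ω Ω)).completeSpace_coe
  let e : H10 Ω ≃ₗ[ℝ] H10In Ω Ω :=
    { toFun := fun v => v, invFun := fun v => v, map_add' := fun _ _ => rfl,
      map_smul' := fun _ _ => rfl, left_inv := fun _ => rfl, right_inv := fun _ => rfl }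
  have hn : ∀ v : H10In Ω Ω, ‖v‖ ^ 2 = ‖v.1.1.fst‖ ^ 2 + ‖v.1.1.snd‖ ^ 2 := fun v =>
    WithLp.prod_norm_sq_eq_of_L2 v.1.1
  have aux₁ : ∀ {a b c : ℝ}, a ^ 2 = b ^ 2 + c ^ 2 → 0 ≤ b → 0 ≤ c → b ≤ C * c →
      a ≤ (C + 1) * c := fun {a b c} h hb hc hbc => by
    refine (abs_le_of_sq_le_sq' ?_ (by positivity)).2
    nlinarith [mul_nonneg hC0 (sq_nonneg c)]
  have aux₂ : ∀ {a b c : ℝ}, a ^ 2 = b ^ 2 + c ^ 2 → 0 ≤ a → c ≤ 1 * a :=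
    fun {a b c} h ha => by
    refine (abs_le_of_sq_le_sq' ?_ (by positivity)).2
    nlinarith [sq_nonneg b]
  have h₁ : ∀ v : H10 Ω, ‖e v‖ ≤ (C + 1) * ‖v‖ := fun v =>
    aux₁ (hn (e v)) (norm_nonneg _) (norm_nonneg _) (hC (e v).1 (e v).2)
  have h₂ : ∀ v : H10In Ω Ω, ‖e.symm v‖ ≤ 1 * ‖v‖ := fun v =>
    aux₂ (hn v) (norm_nonneg _)
  let E := e.toContinuousLinearEquivOfBounds (C + 1) 1 h₁ h₂
  exact (completeSpace_congr (e := E.toEquiv) E.isUniformEmbedding).2 inferInstance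

end H10

/-- `H¹₀(U)`, for an open `U ⊆ Ω`, as a subspace of `H¹₀(Ω)` (extension by zero). -/
def H10Sub (Ω U : Set Plane) : Submodule ℝ (H10 Ω) := (H10In Ω U).comap H10.toH1

/-! ## The L-shaped domain and its cover by two overlapping rectangles -/

/-- `Ω = (-1,1)² \ [-1,0]²`. -/
def lShape : Set Plane :=
  {p | p 0 ∈ Set.Ioo (-1) 1 ∧ p 1 ∈ Set.Ioo (-1) 1} \
    {p | p 0 ∈ Set.Icc (-1) 0 ∧ p 1 ∈ Set.Icc (-1) 0}

/-- `Ω₁ = (-1,1) × (0,1)`. -/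
def lRect₁ : Set Plane := {p | p 0 ∈ Set.Ioo (-1) 1 ∧ p 1 ∈ Set.Ioo 0 1}

/-- `Ω₂ = (0,1) × (-1,1)`. -/
def lRect₂ : Set Plane := {p | p 0 ∈ Set.Ioo 0 1 ∧ p 1 ∈ Set.Ioo (-1) 1}

instance lShape_bounded : Fact (Bornology.IsBounded lShape) := by
  refine ⟨(Metric.isBounded_closedBall (x := (0 : Plane)) (r := 2)).subset fun p hp => ?_⟩
  obtain ⟨⟨⟨h₁, h₂⟩, h₃, h₄⟩, -⟩ := hp
  rw [mem_closedBall_zero_iff]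
  refine abs_le_of_sq_le_sq' ?_ (by norm_num) |>.2
  rw [EuclideanSpace.norm_sq_eq, Fin.sum_univ_two]
  simp only [Real.norm_eq_abs, sq_abs]
  nlinarith

end

/-! ## Decompositions along closed subspaces -/

/-! Let F_k be the fold p_k ↦ -|p_k| of coordinate k. A test function φ on the L-shape splits as v₁
= ½(φ + φ∘F₀ - φ∘F₁) and v₂ = ½(φ - φ∘F₀ + φ∘F₁). Where p₁ ≤ 0, F₁ is the identity and F₀ lands in
the removed quadrant, so v₁ = ½(φ + 0 - φ) = 0; symmetrically v₂ = 0 where p₀ ≤ 0.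

By the parallelogram law the energy density |∇v₁|² + |∇v₂|² equals ½|∇φ|² + ½|∇(φ∘F₀) - ∇(φ∘F₁)|².
On the two arms this is |∇φ|². On the positive quadrant it is at most |∇φ|² + |∇(φ∘F₀)|² +
|∇(φ∘F₁)|², and the last two terms integrate to the energy of φ on the arms, by reflection. The
total is at most twice the energy of φ, whence √2.

The folds are smoothed at scale ε so that v₁ and v₂ remain test functions. This costs O(ε), since
the slopes are bounded uniformly in ε on strips of area O(ε) (`exists_foldPart_energy_le`).

Test functions are dense, and a decomposition bound on a dense subspace extends to H with
arbitrarily small loss by a geometric-series correction. Minimisers exist by projection in a Hilbert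
space, and at a minimiser the loss can be sent to zero (`decompositionConstant_le_of_dense`). -/

theorem completeSpace_piLp {H ι : Type*} [NormedAddCommGroup H] [InnerProductSpace ℝ H]
    [CompleteSpace H] {V : ι → Submodule ℝ H}
    (hV : ∀ i, IsClosed (V i : Set H)) : CompleteSpace (PiLp 2 (fun i => V i)) := by
  have : ∀ i, CompleteSpace (V i) := fun i => (hV i).completeSpace_coe
  infer_instance

section Abstract

variable {H ι : Type*} [NormedAddCommGroup H] [InnerProductSpace ℝ H] [Fintype ι]

/-- The map `(v_i)_i ↦ ∑ i, v_i` on the `ℓ²` sum of a family of subspaces. -/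
noncomputable def sumCLM (V : ι → Submodule ℝ H) : PiLp 2 (fun i => V i) →L[ℝ] H :=
  ∑ i, (V i).subtypeL ∘L PiLp.proj 2 (fun i => V i) i

theorem sumCLM_apply (V : ι → Submodule ℝ H) (p : PiLp 2 (fun i => V i)) :
    sumCLM V p = ∑ i, (p i : H) := by
  simp [sumCLM]

/-- Turns costs into norms of preimages under one bounded operator, so that existence of a minimum
becomes a projection problem and a decomposition bound becomes quantitative surjectivity. -/
theorem mem_decompositionCosts_iff (V : ι → Submodule ℝ H) (v : H) (r : ℝ) :
    r ∈ decompositionCosts V v ↔ ∃ p : PiLp 2 (fun i => V i), sumCLM V p = v ∧ r = ‖p‖ := by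
  constructor
  · rintro ⟨w, hw, rfl, rfl⟩
    refine ⟨WithLp.toLp 2 fun i => ⟨w i, hw i⟩, by simp [sumCLM_apply], ?_⟩
    simp [PiLp.norm_eq_of_L2]
  · rintro ⟨p, rfl, rfl⟩
    refine ⟨fun i => p i, fun i => (p i).2, sumCLM_apply V p, ?_⟩
    simp [PiLp.norm_eq_of_L2]

/-- A vector with some decomposition along closed subspaces has an optimal one. -/
theorem exists_isLeast_decompositionCosts [CompleteSpace H] {V : ι → Submodule ℝ H}
    (hV : ∀ i, IsClosed (V i : Set H)) {v : H} (hv : (decompositionCosts V v).Nonempty) :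
    ∃ r, IsLeast (decompositionCosts V v) r := by
  have := completeSpace_piLp hV
  obtain ⟨r₀, hr₀⟩ := hv
  obtain ⟨p₀, hp₀, -⟩ := (mem_decompositionCosts_iff V v r₀).1 hr₀
  set K : Set (PiLp 2 (fun i => V i)) := sumCLM V ⁻¹' {v} with hK
  have hKc : IsClosed K := isClosed_singleton.preimage (sumCLM V).continuous
  have hKconv : Convex ℝ K := (convex_singleton v).linear_preimage (sumCLM V).toLinearMap
  -- The admissible tuples form a nonempty closed affine set; the projection of 0 onto it is the
  -- optimal decomposition.
  obtain ⟨p, hp, hmin⟩ := exists_norm_eq_iInf_of_complete_convex ⟨p₀, hp₀⟩ hKc.isComplete hKconv 0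
  refine ⟨‖p‖, (mem_decompositionCosts_iff V v _).2 ⟨p, hp, rfl⟩, fun r hr => ?_⟩
  obtain ⟨q, hq, rfl⟩ := (mem_decompositionCosts_iff V v r).1 hr
  have hbdd : BddBelow (Set.range fun w : K => ‖0 - (w : PiLp 2 (fun i => V i))‖) :=
    ⟨0, by rintro _ ⟨w, rfl⟩; exact norm_nonneg _⟩
  have := ciInf_le hbdd ⟨q, hq⟩
  rw [← hmin] at this
  simpa using this

/-- A decomposition bound on a dense subspace extends, up to an arbitrarily small loss. -/
theorem exists_decompositionCosts_le_of_dense [CompleteSpace H] {V : ι → Submodule ℝ H}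
    (hV : ∀ i, IsClosed (V i : Set H)) {D : Submodule ℝ H} (hD : Dense (D : Set H))
    {C ε : ℝ} (hC : 0 < C) (hε : 0 < ε)
    (h : ∀ v ∈ D, ∃ r ∈ decompositionCosts V v, r ≤ C * ‖v‖) (v : H) :
    ∃ r ∈ decompositionCosts V v, r ≤ (C + ε) * ‖v‖ := by
  have := completeSpace_piLp hV
  let f : NormedAddGroupHom (PiLp 2 (fun i => V i)) H :=
    (sumCLM V).toLinearMap.toAddMonoidHom.mkNormedAddGroupHom ‖sumCLM V‖ (sumCLM V).le_opNorm
  have hf : f.SurjectiveOnWith D.toAddSubgroup C := by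
    intro v hv
    obtain ⟨r, hr, hrC⟩ := h v hv
    obtain ⟨p, hp, rfl⟩ := (mem_decompositionCosts_iff V v r).1 hr
    exact ⟨p, hp, hrC⟩
  -- Successive errors are approximated from `D` and decomposed there; the preimages sum to a
  -- convergent series whose tail costs at most `ε * ‖v‖`.
  obtain ⟨p, hp, hpn⟩ := controlled_closure_of_complete hC hε hf v (hD v)
  exact ⟨‖p‖, (mem_decompositionCosts_iff V v _).2 ⟨p, hp, rfl⟩, hpn⟩

/-- If a dense subspace admits decompositions with every constant exceeding `C`, then every vector
has an optimal decomposition, and the decomposition constant is at most `C`. -/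
theorem decompositionConstant_le_of_dense [CompleteSpace H] {V : ι → Submodule ℝ H}
    (hV : ∀ i, IsClosed (V i : Set H)) {D : Submodule ℝ H} (hD : Dense (D : Set H))
    {C : ℝ} (hC : 0 < C)
    (h : ∀ C' > C, ∀ v ∈ D, ∃ r ∈ decompositionCosts V v, r ≤ C' * ‖v‖) :
    (∀ v : H, ∃ r : ℝ, IsLeast (decompositionCosts V v) r) ∧
      decompositionConstant V ≤ ENNReal.ofReal C := by
  have key : ∀ ε > 0, ∀ v : H, ∃ r ∈ decompositionCosts V v, r ≤ (C + ε) * ‖v‖ := by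
    intro ε hε v
    obtain ⟨r, hr, hle⟩ := exists_decompositionCosts_le_of_dense hV hD (C := C + ε / 2)
      (by positivity) (half_pos hε) (h _ (by linarith)) v
    exact ⟨r, hr, hle.trans_eq (by ring)⟩
  have hleast : ∀ v : H, ∃ r : ℝ, IsLeast (decompositionCosts V v) r := fun v =>
    exists_isLeast_decompositionCosts hV (let ⟨r, hr, _⟩ := key 1 one_pos v; ⟨r, hr⟩)
  refine ⟨hleast, iSup₂_le fun v hv => ?_⟩
  obtain ⟨r, hr⟩ := hleast v
  -- The minimum `r` does not depend on ε, so the loss disappears in the limit.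
  have hrC : r ≤ C * ‖v‖ := by
    refine le_of_forall_pos_le_add fun δ hδ => ?_
    have hv' : 0 < ‖v‖ := norm_pos_iff.2 hv
    obtain ⟨q, hq, hqle⟩ := key (δ / ‖v‖) (by positivity) v
    refine (hr.2 hq).trans (hqle.trans_eq ?_)
    field_simp
  refine ENNReal.div_le_of_le_mul ((iInf₂_le r hr.1).trans ?_)
  rw [← ENNReal.ofReal_mul hC.le]
  exact ENNReal.ofReal_le_ofReal hrC

end Abstract

/-! ## Test functions in `H¹₀(Ω)` -/

theorem gradient_apply_eq_fderiv (φ : Plane → ℝ) (p : Plane) (i : Fin 2) :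
    gradient φ p i = fderiv ℝ φ p (EuclideanSpace.single i 1) := by
  have := InnerProductSpace.toDual_symm_apply (𝕜 := ℝ) (x := EuclideanSpace.single i (1 : ℝ))
    (y := fderiv ℝ φ p)
  rw [← this, EuclideanSpace.inner_single_right]
  simp [gradient]

theorem norm_gradient_sq (φ : Plane → ℝ) (p : Plane) :
    ‖gradient φ p‖ ^ 2 = fderiv ℝ φ p (EuclideanSpace.single 0 1) ^ 2 +
      fderiv ℝ φ p (EuclideanSpace.single 1 1) ^ 2 := by
  simp [EuclideanSpace.norm_sq_eq, Fin.sum_univ_two, gradient_apply_eq_fderiv]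

theorem gradient_eq_zero_of_notMem {φ : Plane → ℝ} {p : Plane} (hp : p ∉ tsupport φ) :
    gradient φ p = 0 := by
  simp [gradient, fderiv_of_notMem_tsupport ℝ hp]

theorem IsTestFunction.mono {U V : Set Plane} (h : U ⊆ V) {φ : Plane → ℝ}
    (hφ : IsTestFunction U φ) : IsTestFunction V φ :=
  ⟨hφ.1, hφ.2.1, hφ.2.2.trans h⟩

/-- Both integrands vanish off `Ω`, so the integrals extend to the plane, where integration by parts
in each coordinate has no boundary term. -/
theorem IsTestFunction.isWeakGradient {Ω : Set Plane} {φ : Plane → ℝ}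
    (hφ : IsTestFunction Ω φ) : IsWeakGradient Ω φ (gradient φ) := by
  intro ψ hψ
  rw [setIntegral_eq_integral_of_forall_compl_eq_zero (fun x hx => by
      rw [image_eq_zero_of_notMem_tsupport fun h => hx (hφ.2.2 h), zero_smul]),
    setIntegral_eq_integral_of_forall_compl_eq_zero (fun x hx => by
      rw [image_eq_zero_of_notMem_tsupport fun h => hx (hψ.2.2 h), zero_smul])]
  have hi : ∀ {φ ψ : Plane → ℝ}, IsTestFunction Ω φ → IsTestFunction Ω ψ →
      Integrable fun x => φ x • gradient ψ x := fun {φ ψ} hφ hψ =>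
    memLp_one_iff_integrable.1 ((hψ.memLp_gradient volume).smul (hφ.memLp volume))
  have hi' : ∀ {φ ψ : Plane → ℝ}, IsTestFunction Ω φ → IsTestFunction Ω ψ → ∀ i : Fin 2,
      Integrable fun x => φ x * fderiv ℝ ψ x (EuclideanSpace.single i 1) := by
    intro φ ψ hφ hψ i
    refine ((EuclideanSpace.proj (𝕜 := ℝ) i).integrable_comp (hi hφ hψ)).congr ?_
    exact .of_forall fun x => by simp [gradient_apply_eq_fderiv]
  have hc : ∀ {φ ψ : Plane → ℝ}, IsTestFunction Ω φ → IsTestFunction Ω ψ → ∀ i : Fin 2,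
      (∫ x, φ x • gradient ψ x) i =
        ∫ x, φ x * fderiv ℝ ψ x (EuclideanSpace.single i 1) := by
    intro φ ψ hφ hψ i
    have := (EuclideanSpace.proj (𝕜 := ℝ) i).integral_comp_comm (hi hφ hψ)
    refine this.symm.trans (integral_congr_ae (.of_forall fun x => ?_))
    simp [gradient_apply_eq_fderiv]
  ext i
  rw [PiLp.neg_apply, hc hφ hψ, hc hψ hφ,
    integral_mul_fderiv_eq_neg_fderiv_mul_of_integrable]
  · simp only [mul_comm]
  · simpa only [mul_comm] using hi' hψ hφ i
  · exact hi' hφ hψ i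
  · exact memLp_one_iff_integrable.1 ((hψ.memLp volume).mul (hφ.memLp volume))
  · exact fun x _ => hφ.1.differentiable (by simp) x
  · exact fun x _ => hψ.1.differentiable (by simp) x

/-- A test function as an element of `H¹(Ω)`. -/
noncomputable def IsTestFunction.toH1 {Ω : Set Plane} {φ : Plane → ℝ} (hφ : IsTestFunction Ω φ) :
    H1 Ω :=
  ⟨WithLp.toLp 2 ((hφ.memLp (volume.restrict Ω)).toLp φ,
    (hφ.memLp_gradient (volume.restrict Ω)).toLp (gradient φ)),
    hφ.isWeakGradient.congr (hφ.memLp (volume.restrict Ω)).coeFn_toLp.symm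
      (hφ.memLp_gradient (volume.restrict Ω)).coeFn_toLp.symm⟩

theorem IsTestFunction.toH1_mem_testSubspace {Ω U : Set Plane} {φ : Plane → ℝ}
    (hφ : IsTestFunction Ω φ) (h : IsTestFunction U φ) : hφ.toH1 ∈ testSubspace Ω U :=
  ⟨φ, h, (hφ.memLp (volume.restrict Ω)).coeFn_toLp,
    (hφ.memLp_gradient (volume.restrict Ω)).coeFn_toLp⟩

/-- A test function as an element of `H¹₀(Ω)`. -/
noncomputable def IsTestFunction.toH10 {Ω : Set Plane} {φ : Plane → ℝ} (hφ : IsTestFunction Ω φ) :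
    H10 Ω :=
  ⟨hφ.toH1, Submodule.le_topologicalClosure _ (hφ.toH1_mem_testSubspace hφ)⟩

theorem IsTestFunction.toH10_mem_H10Sub {Ω U : Set Plane} {φ : Plane → ℝ}
    (hφ : IsTestFunction Ω φ) (h : IsTestFunction U φ) : hφ.toH10 ∈ H10Sub Ω U :=
  Submodule.le_topologicalClosure _ (hφ.toH1_mem_testSubspace h)

theorem IsTestFunction.grad_toH10_ae_eq {Ω : Set Plane} {φ : Plane → ℝ}
    (hφ : IsTestFunction Ω φ) : H10.grad hφ.toH10 =ᵐ[volume.restrict Ω] gradient φ :=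
  (hφ.memLp_gradient (volume.restrict Ω)).coeFn_toLp

/-! ### Dirichlet norm against `H¹` norm -/

section Dirichlet

variable {Ω : Set Plane} [hΩ : Fact (Bornology.IsBounded Ω)]

theorem H10.norm_eq (v : H10 Ω) : ‖v‖ = ‖H10.grad v‖ := rfl

/-- Only the gradient of `v` is compared with that of `φ`, since the Dirichlet norm sees nothing
else. -/
theorem H10.norm_sq_eq_integral {v : H10 Ω} {φ : Plane → ℝ} (hφ : IsTestFunction Ω φ)
    (hv : H10.grad v =ᵐ[volume.restrict Ω] gradient φ) :
    ‖v‖ ^ 2 = ∫ x, ‖gradient φ x‖ ^ 2 := by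
  have h : ‖v‖ ^ 2 = inner ℝ (H10.grad v) (H10.grad v) := by
    rw [H10.norm_eq, real_inner_self_eq_norm_sq]
  rw [h, L2.inner_def, integral_congr_ae (g := fun x => ‖gradient φ x‖ ^ 2),
    setIntegral_eq_integral_of_forall_compl_eq_zero]
  · intro x hx
    rw [gradient_eq_zero_of_notMem fun h => hx (hφ.2.2 h)]; simp
  · filter_upwards [hv] with x hx
    rw [hx, real_inner_self_eq_norm_sq]

theorem IsTestFunction.norm_toH10_sq {φ : Plane → ℝ} (hφ : IsTestFunction Ω φ) :
    ‖hφ.toH10‖ ^ 2 = ∫ x, ‖gradient φ x‖ ^ 2 :=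
  H10.norm_sq_eq_integral hφ hφ.grad_toH10_ae_eq

/-- The Poincaré inequality bounds the `H¹` norm by √(C² + 1) ≤ C + 1 times the Dirichlet norm. This
transfers closedness from `H¹` to the Dirichlet topology. -/
theorem H10.continuous_toH1 : Continuous (H10.toH1 : H10 Ω → H1 Ω) := by
  obtain ⟨C, hC0, hC⟩ := poincare Ω hΩ.out
  refine AddMonoidHomClass.continuous_of_bound (H10.toH1 (Ω := Ω)) (C + 1) fun v => ?_
  have hn : ‖H10.toH1 v‖ ^ 2 = ‖(H10.toH1 v).1.fst‖ ^ 2 + ‖(H10.toH1 v).1.snd‖ ^ 2 :=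
    WithLp.prod_norm_sq_eq_of_L2 (H10.toH1 v).1
  have h1 := hC (H10.toH1 v) v.2
  have h2 : ‖v‖ = ‖(H10.toH1 v).1.snd‖ := rfl
  rw [h2]
  set a := ‖(H10.toH1 v).1.fst‖
  set b := ‖(H10.toH1 v).1.snd‖
  have ha : 0 ≤ a := norm_nonneg _
  have hb : 0 ≤ b := norm_nonneg _
  refine (abs_le_of_sq_le_sq' ?_ (by positivity)).2
  nlinarith [mul_nonneg hC0 (sq_nonneg b)]

theorem isClosed_H10Sub (U : Set Plane) : IsClosed (H10Sub Ω U : Set (H10 Ω)) :=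
  (Submodule.isClosed_topologicalClosure (testSubspace Ω U)).preimage H10.continuous_toH1

/-- Density holds in the `H¹` norm by construction, and the Dirichlet norm is the smaller one. -/
theorem dense_testSubspace :
    Dense ((testSubspace Ω Ω).comap H10.toH1 : Set (H10 Ω)) := by
  intro v
  rw [Metric.mem_closure_iff]
  intro ε hε
  have hv : H10.toH1 v ∈ closure (testSubspace Ω Ω : Set (H1 Ω)) := v.2
  obtain ⟨w, hw, hd⟩ := Metric.mem_closure_iff.1 hv ε hε
  let w' : H10 Ω := ⟨w, Submodule.le_topologicalClosure _ hw⟩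
  refine ⟨w', hw, lt_of_le_of_lt ?_ hd⟩
  rw [dist_eq_norm, dist_eq_norm]
  have hn : ‖H10.toH1 v - w‖ ^ 2 =
      ‖(H10.toH1 v - w).1.fst‖ ^ 2 + ‖(H10.toH1 v - w).1.snd‖ ^ 2 :=
    WithLp.prod_norm_sq_eq_of_L2 (H10.toH1 v - w).1
  have h2 : ‖v - w'‖ = ‖(H10.toH1 v - w).1.snd‖ := rfl
  rw [h2]
  refine (abs_le_of_sq_le_sq' ?_ (norm_nonneg _)).2
  rw [hn]
  exact le_add_of_nonneg_left (sq_nonneg _)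

end Dirichlet

/-! ## Smooth folding maps -/

/-- A smooth approximation of `t ↦ -|t|`, equal to `t` for `t ≤ ε` and to `-t` for `2ε ≤ t`. -/
noncomputable def smoothFold (ε t : ℝ) : ℝ := t * (1 - 2 * Real.smoothTransition (t / ε - 1))

section SmoothFold

variable {ε t : ℝ}

theorem contDiff_smoothFold (ε : ℝ) : ContDiff ℝ ∞ (smoothFold ε) := by
  have h : ContDiff ℝ ∞ fun t : ℝ => Real.smoothTransition (t / ε - 1) :=
    Real.smoothTransition.contDiff.comp ((contDiff_id.div_const ε).sub contDiff_const)
  exact contDiff_id.mul (contDiff_const.sub (contDiff_const.mul h))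

theorem smoothFold_of_le (hε : 0 < ε) (ht : t ≤ ε) : smoothFold ε t = t := by
  have : t / ε - 1 ≤ 0 := by rw [sub_nonpos, div_le_one hε]; exact ht
  simp [smoothFold, Real.smoothTransition.zero_of_nonpos this]

theorem smoothFold_of_ge (hε : 0 < ε) (ht : 2 * ε ≤ t) : smoothFold ε t = -t := by
  have : 1 ≤ t / ε - 1 := by rw [le_sub_iff_add_le, le_div_iff₀ hε]; linarith
  rw [smoothFold, Real.smoothTransition.one_of_one_le this]; ring

theorem abs_smoothFold_le (ε t : ℝ) : |smoothFold ε t| ≤ |t| := by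
  rw [smoothFold, abs_mul]
  refine mul_le_of_le_one_right (abs_nonneg t) (abs_le.2 ⟨?_, ?_⟩)
  · linarith [Real.smoothTransition.le_one (t / ε - 1)]
  · linarith [Real.smoothTransition.nonneg (t / ε - 1)]

theorem smoothFold_le (hε : 0 < ε) (t : ℝ) : smoothFold ε t ≤ 2 * ε := by
  rcases le_total t ε with h | h
  · rw [smoothFold_of_le hε h]; linarith
  rcases le_total (2 * ε) t with h' | h'
  · rw [smoothFold_of_ge hε h']; linarith
  · refine (le_abs_self _).trans ((abs_smoothFold_le ε t).trans ?_)
    rwa [abs_of_nonneg (hε.le.trans h)]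

/-- The fold can shrink `|t|` only for `t` between `ε` and `2 * ε`, and there `t` is already below
`c`. -/
theorem abs_le_of_abs_smoothFold_le {c : ℝ} (hε : 0 < ε) (hc : 2 * ε ≤ c)
    (h : |smoothFold ε t| ≤ c) : |t| ≤ c := by
  rcases le_total t ε with h₁ | h₁
  · rwa [smoothFold_of_le hε h₁] at h
  rcases le_total (2 * ε) t with h₂ | h₂
  · rwa [smoothFold_of_ge hε h₂, abs_neg] at h
  · rw [abs_of_nonneg (hε.le.trans h₁)]; exact h₂.trans hc

theorem deriv_smoothFold_of_gt (hε : 0 < ε) (ht : 2 * ε < t) : deriv (smoothFold ε) t = -1 := by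
  have : smoothFold ε =ᶠ[nhds t] fun t => -t := by
    filter_upwards [lt_mem_nhds ht] with s hs using smoothFold_of_ge hε hs.le
  rw [this.deriv_eq, deriv_neg]

theorem deriv_smoothFold_of_lt (hε : 0 < ε) (ht : t < ε) : deriv (smoothFold ε) t = 1 := by
  have : smoothFold ε =ᶠ[nhds t] fun t => t := by
    filter_upwards [gt_mem_nhds ht] with s hs using smoothFold_of_le hε hs.le
  rw [this.deriv_eq, deriv_id'']

/-- By scaling, the slope at `t` is that of `smoothFold 1` at `t / ε`. In the transition zone this
point lies in the compact interval [1, 2], so the bound is independent of ε. -/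
theorem exists_abs_deriv_smoothFold_le :
    ∃ L : ℝ, 1 ≤ L ∧ ∀ ε > 0, ∀ t, |deriv (smoothFold ε) t| ≤ L := by
  obtain ⟨K, hK⟩ := isCompact_Icc (a := (1 : ℝ)) (b := 2) |>.exists_bound_of_continuousOn
    (((contDiff_smoothFold 1).continuous_deriv (by simp)).continuousOn)
  refine ⟨max 1 K, le_max_left _ _, fun ε hε t => ?_⟩
  rcases lt_or_ge t ε with h₁ | h₁
  · rw [deriv_smoothFold_of_lt hε h₁]; simp
  rcases lt_or_ge (2 * ε) t with h₂ | h₂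
  · rw [deriv_smoothFold_of_gt hε h₂]; simp
  have hs : smoothFold ε = fun t => ε * smoothFold 1 (ε⁻¹ * t) := by
    ext t
    simp only [smoothFold]
    field_simp
  have hd : deriv (smoothFold ε) t = deriv (smoothFold 1) (ε⁻¹ * t) := by
    rw [hs, deriv_const_mul_field, deriv_comp_mul_left, smul_eq_mul]
    field_simp
  rw [hd]
  refine (hK _ ⟨?_, ?_⟩).trans (le_max_right _ _)
  · rw [inv_mul_eq_div, le_div_iff₀ hε]; linarith
  · rw [inv_mul_eq_div, div_le_iff₀ hε]; linarith

end SmoothFold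

/-- The map of the plane that applies `smoothFold ε` to the coordinate `i`. -/
noncomputable def planeFold (i : Fin 2) (ε : ℝ) (p : Plane) : Plane :=
  p + (smoothFold ε (p i) - p i) • EuclideanSpace.single i 1

/-- The reflection of the plane that changes the sign of the coordinate `i`. -/
noncomputable def planeReflection (i : Fin 2) : Plane ≃ₗᵢ[ℝ] Plane :=
  LinearIsometryEquiv.piLpCongrRight 2 fun k =>
    if k = i then LinearIsometryEquiv.neg ℝ else LinearIsometryEquiv.refl ℝ ℝ

section PlaneFold

variable {i j : Fin 2} {ε : ℝ} {p : Plane}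

theorem planeFold_apply_same (i : Fin 2) (ε : ℝ) (p : Plane) :
    planeFold i ε p i = smoothFold ε (p i) := by
  simp [planeFold]

theorem planeFold_apply_ne (hij : j ≠ i) (ε : ℝ) (p : Plane) : planeFold i ε p j = p j := by
  simp [planeFold, hij]

theorem planeFold_of_le (hε : 0 < ε) (h : p i ≤ ε) : planeFold i ε p = p := by
  simp [planeFold, smoothFold_of_le hε h]

theorem planeReflection_apply_same (i : Fin 2) (p : Plane) : planeReflection i p i = -p i := by
  simp [planeReflection]

theorem planeReflection_apply_ne (hij : j ≠ i) (p : Plane) : planeReflection i p j = p j := by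
  simp [planeReflection, hij]

theorem planeFold_of_ge (hε : 0 < ε) (h : 2 * ε ≤ p i) : planeFold i ε p = planeReflection i p := by
  ext k
  by_cases hk : k = i
  · subst hk
    rw [planeFold_apply_same, planeReflection_apply_same, smoothFold_of_ge hε h]
  · rw [planeFold_apply_ne hk, planeReflection_apply_ne hk]

theorem contDiff_planeFold (i : Fin 2) (ε : ℝ) : ContDiff ℝ ∞ (planeFold i ε) := by
  have hp : ContDiff ℝ ∞ fun p : Plane => p i := (EuclideanSpace.proj (𝕜 := ℝ) i).contDiff
  exact contDiff_id.add ((((contDiff_smoothFold ε).comp hp).sub hp).smul contDiff_const)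

theorem hasFDerivAt_planeFold (i : Fin 2) (ε : ℝ) (p : Plane) :
    HasFDerivAt (planeFold i ε) (ContinuousLinearMap.id ℝ Plane +
      ((deriv (smoothFold ε) (p i) - 1) • EuclideanSpace.proj (𝕜 := ℝ) i).smulRight
        (EuclideanSpace.single i (1 : ℝ))) p := by
  have hp : HasFDerivAt (fun p : Plane => p i) (EuclideanSpace.proj (𝕜 := ℝ) i) p :=
    (EuclideanSpace.proj (𝕜 := ℝ) i).hasFDerivAt
  have hs : HasDerivAt (smoothFold ε) (deriv (smoothFold ε) (p i)) (p i) :=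
    ((contDiff_smoothFold ε).differentiable (by simp) _).hasDerivAt
  have := (hasFDerivAt_id p).add (((hs.comp_hasFDerivAt p hp).sub hp).smul_const
    (EuclideanSpace.single i (1 : ℝ)))
  rw [sub_smul, one_smul]
  exact this

theorem fderiv_comp_planeFold_same {φ : Plane → ℝ} (hφ : ContDiff ℝ ∞ φ) (i : Fin 2) (ε : ℝ)
    (p : Plane) :
    fderiv ℝ (φ ∘ planeFold i ε) p (EuclideanSpace.single i 1) =
      deriv (smoothFold ε) (p i) * fderiv ℝ φ (planeFold i ε p) (EuclideanSpace.single i 1) := by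
  have h := ((hφ.differentiable (by simp) (planeFold i ε p)).hasFDerivAt).comp p
    (hasFDerivAt_planeFold i ε p)
  rw [h.fderiv]
  simp
  ring

theorem fderiv_comp_planeFold_ne {φ : Plane → ℝ} (hφ : ContDiff ℝ ∞ φ) (hij : j ≠ i) (ε : ℝ)
    (p : Plane) :
    fderiv ℝ (φ ∘ planeFold i ε) p (EuclideanSpace.single j 1) =
      fderiv ℝ φ (planeFold i ε p) (EuclideanSpace.single j 1) := by
  have h := ((hφ.differentiable (by simp) (planeFold i ε p)).hasFDerivAt).comp p
    (hasFDerivAt_planeFold i ε p)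
  rw [h.fderiv]
  simp [hij.symm]

theorem norm_gradient_sq_of_ne (hij : i ≠ j) (φ : Plane → ℝ) (p : Plane) :
    ‖gradient φ p‖ ^ 2 = fderiv ℝ φ p (EuclideanSpace.single i 1) ^ 2 +
      fderiv ℝ φ p (EuclideanSpace.single j 1) ^ 2 := by
  rw [norm_gradient_sq]
  fin_cases i <;> fin_cases j <;> simp_all [add_comm]

theorem norm_gradient_comp_planeFold_sq_le {φ : Plane → ℝ} (hφ : ContDiff ℝ ∞ φ) (i : Fin 2)
    {L : ℝ} (hL : 1 ≤ L) (ε : ℝ) (p : Plane) (hd : |deriv (smoothFold ε) (p i)| ≤ L) :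
    ‖gradient (φ ∘ planeFold i ε) p‖ ^ 2 ≤ L ^ 2 * ‖gradient φ (planeFold i ε p)‖ ^ 2 := by
  obtain ⟨j, hj⟩ := exists_ne i
  rw [norm_gradient_sq_of_ne hj.symm, norm_gradient_sq_of_ne hj.symm,
    fderiv_comp_planeFold_same hφ, fderiv_comp_planeFold_ne hφ hj, mul_pow, mul_add]
  have h₁ : deriv (smoothFold ε) (p i) ^ 2 ≤ L ^ 2 := sq_le_sq' (abs_le.1 hd).1 (abs_le.1 hd).2
  refine add_le_add (mul_le_mul_of_nonneg_right h₁ (sq_nonneg _)) ?_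
  -- The unfolded derivative carries no factor; `1 ≤ L` absorbs it.
  exact le_mul_of_one_le_left (sq_nonneg _) (one_le_pow₀ hL)

end PlaneFold

/-! ## The decomposition of a test function -/

/-- `φ` vanishes outside the square of half-side `1 - m` and on the quadrant
`{p | p 0 ≤ m, p 1 ≤ m}`. -/
def HasMargin (m : ℝ) (φ : Plane → ℝ) : Prop :=
  ∀ p, φ p ≠ 0 → (∀ k, |p k| ≤ 1 - m) ∧ ∃ k, m < p k

/-- The component of `φ` supported in the rectangle `{p | p i ∈ (-1, 1), p j ∈ (0, 1)}`. -/
noncomputable def foldPart (i j : Fin 2) (ε : ℝ) (φ : Plane → ℝ) (p : Plane) : ℝ :=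
  2⁻¹ * (φ p + (φ ∘ planeFold i ε) p - (φ ∘ planeFold j ε) p)

theorem exists_hasMargin {φ : Plane → ℝ} (hφ : IsTestFunction lShape φ) :
    ∃ m, 0 < m ∧ m ≤ 1 / 2 ∧ HasMargin m φ := by
  -- `d` is positive exactly on the L-shape, hence bounded below by some `a > 0` on the compact
  -- support.
  let d : Plane → ℝ := fun p => min (max (p 0) (p 1)) (min (1 - |p 0|) (1 - |p 1|))
  have hd : Continuous d := by fun_prop
  obtain ⟨a, ha, hle⟩ := hφ.2.1.isCompact.exists_forall_le' (a := 0) hd.continuousOn (by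
    intro p hp
    obtain ⟨⟨h₀, h₁⟩, h⟩ := hφ.2.2 hp
    refine lt_min ?_ (lt_min (sub_pos.2 (abs_lt.2 h₀)) (sub_pos.2 (abs_lt.2 h₁)))
    by_contra! hm
    exact h ⟨⟨h₀.1.le, (le_max_left _ _).trans hm⟩, ⟨h₁.1.le, (le_max_right _ _).trans hm⟩⟩)
  -- Halving `a` makes `m < p k` strict; the cap 1/2 ensures `m ≤ 1 - m`, used to control supports
  -- after folding.
  refine ⟨min (a / 2) (1 / 2), by positivity, min_le_right _ _, fun p hp => ?_⟩
  have h := hle p (subset_tsupport φ hp)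
  have hma : min (a / 2) (1 / 2) < a := (min_le_left _ _).trans_lt (half_lt_self ha)
  simp only [d, le_min_iff, le_max_iff] at h
  obtain ⟨hmax, h₀, h₁⟩ := h
  refine ⟨fun k => ?_, ?_⟩
  · fin_cases k
    · change |p 0| ≤ _; linarith
    · change |p 1| ≤ _; linarith
  · rcases hmax with h | h
    exacts [⟨0, hma.trans_le h⟩, ⟨1, hma.trans_le h⟩]

theorem isCompact_planeBox : IsCompact {p : Plane | ∀ k, |p k| ≤ 1} := by
  refine Metric.isCompact_of_isClosed_isBounded ?_
    ((Metric.isBounded_closedBall (x := (0 : Plane)) (r := 2)).subset fun p hp => ?_)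
  · simp only [Set.ofPred_forall]
    exact isClosed_iInter fun k => isClosed_le (by fun_prop) continuous_const
  · rw [mem_closedBall_zero_iff]
    refine abs_le_of_sq_le_sq' ?_ (by norm_num) |>.2
    rw [EuclideanSpace.norm_sq_eq, Fin.sum_univ_two]
    have h₀ := hp 0
    have h₁ := hp 1
    simp only [Real.norm_eq_abs]
    nlinarith [abs_nonneg (p 0), abs_nonneg (p 1)]

section FoldPart

variable {i j : Fin 2} {m ε : ℝ} {φ : Plane → ℝ}

theorem HasMargin.eq_zero_of_le (h : HasMargin m φ) (hij : i ≠ j) {p : Plane} (hi : p i ≤ m)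
    (hj : p j ≤ m) : φ p = 0 := by
  by_contra hp
  obtain ⟨-, k, hk⟩ := h p hp
  have : k = i ∨ k = j := by omega
  rcases this with rfl | rfl <;> linarith

/-- The folded point has both coordinates at most `m`, because the smooth fold never exceeds `2 *
ε`; there `φ` vanishes. -/
theorem HasMargin.comp_planeFold_eq_zero (h : HasMargin m φ) (hε : 0 < ε) (hεm : 2 * ε ≤ m)
    (hij : i ≠ j) {p : Plane} (hj : p j ≤ ε) : (φ ∘ planeFold i ε) p = 0 := by
  refine h.eq_zero_of_le hij ?_ ?_
  · rw [planeFold_apply_same]; exact (smoothFold_le hε _).trans hεm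
  · rw [planeFold_apply_ne hij.symm]; linarith

theorem HasMargin.foldPart_ne_zero (h : HasMargin m φ) (hm : m ≤ 1 / 2) (hε : 0 < ε)
    (hεm : 2 * ε ≤ m) (hij : i ≠ j) {p : Plane} (hp : foldPart i j ε φ p ≠ 0) :
    (∀ k, |p k| ≤ 1 - m) ∧ ε ≤ p j := by
  constructor
  · have hcomp : ∀ l, φ (planeFold l ε p) ≠ 0 → ∀ k, |p k| ≤ 1 - m := by
      intro l hl k
      have hk := (h _ hl).1 k
      by_cases hkl : k = l
      · subst hkl
        rw [planeFold_apply_same] at hk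
        exact abs_le_of_abs_smoothFold_le hε (by linarith) hk
      · rwa [planeFold_apply_ne hkl] at hk
    by_cases h₀ : φ p = 0
    · by_cases hi : φ (planeFold i ε p) = 0
      · by_cases hj : φ (planeFold j ε p) = 0
        · exact absurd (by simp [foldPart, h₀, hi, hj]) hp
        · exact hcomp j hj
      · exact hcomp i hi
    · exact (h p h₀).1
  -- Below level ε the fold in `j` is the identity and the fold in `i` gives zero, leaving ½(φ + 0 -
  -- φ).
  · by_contra! hlt
    refine hp ?_
    rw [foldPart, h.comp_planeFold_eq_zero hε hεm hij hlt.le, Function.comp_apply,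
      planeFold_of_le hε hlt.le]
    ring

theorem HasMargin.isTestFunction_foldPart (h : HasMargin m φ) (hφ : ContDiff ℝ ∞ φ) (hm₀ : 0 < m)
    (hm : m ≤ 1 / 2) (hε : 0 < ε) (hεm : 2 * ε ≤ m) (hij : i ≠ j) :
    IsTestFunction {p | p i ∈ Set.Ioo (-1) 1 ∧ p j ∈ Set.Ioo 0 1} (foldPart i j ε φ) := by
  set K : Set Plane := {p | (∀ k, |p k| ≤ 1 - m) ∧ ε ≤ p j}
  have hKc : IsClosed K := by
    have hK : K = {p : Plane | ∀ k, |p k| ≤ 1 - m} ∩ {p : Plane | ε ≤ p j} := rfl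
    rw [hK]
    refine IsClosed.inter ?_ (isClosed_le continuous_const (by fun_prop))
    simp only [Set.ofPred_forall]
    exact isClosed_iInter fun k => isClosed_le (by fun_prop) continuous_const
  have hK : IsCompact K :=
    isCompact_planeBox.of_isClosed_subset hKc fun p hp k => (hp.1 k).trans (sub_le_self 1 hm₀.le)
  have hsub : Function.support (foldPart i j ε φ) ⊆ K := fun p hp =>
    h.foldPart_ne_zero hm hε hεm hij hp
  refine ⟨?_, HasCompactSupport.of_support_subset_isCompact hK hsub,
    (closure_minimal hsub hKc).trans fun p hp => ?_⟩
  · exact contDiff_const.mul ((hφ.add (hφ.comp (contDiff_planeFold i ε))).sub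
      (hφ.comp (contDiff_planeFold j ε)))
  · have hi := abs_le.1 (hp.1 i)
    have hj := abs_le.1 (hp.1 j)
    exact ⟨⟨by linarith, by linarith⟩, hε.trans_le hp.2, by linarith⟩

theorem gradient_foldPart (hφ : ContDiff ℝ ∞ φ) (i j : Fin 2) (ε : ℝ) (p : Plane) :
    gradient (foldPart i j ε φ) p = (2⁻¹ : ℝ) • (gradient φ p +
      gradient (φ ∘ planeFold i ε) p - gradient (φ ∘ planeFold j ε) p) := by
  have hd : ∀ l, DifferentiableAt ℝ (φ ∘ planeFold l ε) p := fun l =>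
    (hφ.comp (contDiff_planeFold l ε)).differentiable (by simp) p
  have h := (((hφ.differentiable (by simp) p).hasFDerivAt.add (hd i).hasFDerivAt).sub
    (hd j).hasFDerivAt).const_mul (2⁻¹ : ℝ)
  have h' : fderiv ℝ (foldPart i j ε φ) p = _ := h.fderiv
  simp only [gradient, h', map_smul, map_add, map_sub]

/-- The two gradients are ½(u + (a - b)) and ½(u - (a - b)), so the parallelogram law removes the
cross term. -/
theorem norm_gradient_foldPart_sq_add (hφ : ContDiff ℝ ∞ φ) (i j : Fin 2) (ε : ℝ) (p : Plane) :
    ‖gradient (foldPart i j ε φ) p‖ ^ 2 + ‖gradient (foldPart j i ε φ) p‖ ^ 2 =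
      2⁻¹ * ‖gradient φ p‖ ^ 2 + 2⁻¹ * ‖gradient (φ ∘ planeFold i ε) p -
        gradient (φ ∘ planeFold j ε) p‖ ^ 2 := by
  rw [gradient_foldPart hφ, gradient_foldPart hφ]
  set u := gradient φ p
  set a := gradient (φ ∘ planeFold i ε) p
  set b := gradient (φ ∘ planeFold j ε) p
  have h := parallelogram_law_with_norm ℝ u (a - b)
  rw [norm_smul, norm_smul, add_sub_assoc, add_sub_assoc, ← neg_sub a b, ← sub_eq_add_neg]
  norm_num
  linarith

theorem norm_sub_sq_le_two_mul (a b : Plane) : ‖a - b‖ ^ 2 ≤ 2 * ‖a‖ ^ 2 + 2 * ‖b‖ ^ 2 := by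
  have h := parallelogram_law_with_norm ℝ a b
  nlinarith [mul_self_nonneg ‖a + b‖]

/-- Near a point with `p i < ε`, the folded functions are `φ` and `0`. -/
theorem HasMargin.norm_gradient_foldPart_sq_add_of_lt (h : HasMargin m φ) (hφ : ContDiff ℝ ∞ φ)
    (hε : 0 < ε) (hεm : 2 * ε ≤ m) (hij : i ≠ j) {p : Plane} (hp : p i < ε) :
    ‖gradient (foldPart i j ε φ) p‖ ^ 2 + ‖gradient (foldPart j i ε φ) p‖ ^ 2 =
      ‖gradient φ p‖ ^ 2 := by
  have hopen : ∀ᶠ q : Plane in nhds p, q i < ε :=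
    (isOpen_lt (by fun_prop) continuous_const).mem_nhds hp
  have h₁ : gradient (φ ∘ planeFold i ε) p = gradient φ p := by
    have : φ ∘ planeFold i ε =ᶠ[nhds p] φ := by
      filter_upwards [hopen] with q hq
      rw [Function.comp_apply, planeFold_of_le hε hq.le]
    rw [gradient, this.fderiv_eq, gradient]
  have h₂ : gradient (φ ∘ planeFold j ε) p = 0 := by
    have : φ ∘ planeFold j ε =ᶠ[nhds p] fun _ => 0 := by
      filter_upwards [hopen] with q hq using h.comp_planeFold_eq_zero hε hεm hij.symm hq.le
    rw [gradient, this.fderiv_eq]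
    simp
  rw [norm_gradient_foldPart_sq_add hφ, h₁, h₂, sub_zero]
  ring

/-- Relaxing the coefficient ½ of `‖gradient φ p‖ ^ 2` to 1 does not worsen the final factor 2,
which the arms already produce. -/
theorem norm_gradient_foldPart_sq_add_le (hφ : ContDiff ℝ ∞ φ) {L : ℝ} (hL : 1 ≤ L) {p : Plane}
    (hd : ∀ k, |deriv (smoothFold ε) (p k)| ≤ L) (i j : Fin 2) :
    ‖gradient (foldPart i j ε φ) p‖ ^ 2 + ‖gradient (foldPart j i ε φ) p‖ ^ 2 ≤
      ‖gradient φ p‖ ^ 2 + L ^ 2 * ‖gradient φ (planeFold i ε p)‖ ^ 2 +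
        L ^ 2 * ‖gradient φ (planeFold j ε p)‖ ^ 2 := by
  rw [norm_gradient_foldPart_sq_add hφ]
  have h₁ := norm_gradient_comp_planeFold_sq_le hφ i hL ε p (hd i)
  have h₂ := norm_gradient_comp_planeFold_sq_le hφ j hL ε p (hd j)
  have h₃ := norm_sub_sq_le_two_mul (gradient (φ ∘ planeFold i ε) p)
    (gradient (φ ∘ planeFold j ε) p)
  nlinarith [sq_nonneg ‖gradient φ p‖]

end FoldPart

/-! ## The energy estimate -/

/-- The part of the square `[-1, 1]²` on which `planeFold i ε` is neither the identity nor a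
reflection. -/
def foldStrip (i : Fin 2) (ε : ℝ) : Set Plane := {p | p i ∈ Set.Icc ε (2 * ε) ∧ ∀ k, |p k| ≤ 1}

section Energy

variable {i j : Fin 2} {m ε : ℝ} {φ : Plane → ℝ}

theorem isClosed_foldStrip (i : Fin 2) (ε : ℝ) : IsClosed (foldStrip i ε) := by
  have h : foldStrip i ε = ((fun p : Plane => p i) ⁻¹' Set.Icc ε (2 * ε)) ∩
      {p : Plane | ∀ k, |p k| ≤ 1} := rfl
  rw [h]
  exact (isClosed_Icc.preimage (by fun_prop)).inter isCompact_planeBox.isClosed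

theorem volume_foldStrip_ne_top (i : Fin 2) (ε : ℝ) : volume (foldStrip i ε) ≠ ⊤ :=
  ((measure_mono fun p (hp : p ∈ foldStrip i ε) => hp.2).trans_lt isCompact_planeBox.measure_lt_top).ne

theorem volume_real_foldStrip_le (i : Fin 2) (hε : 0 < ε) :
    volume.real (foldStrip i ε) ≤ 2 * ε := by
  let S : Set (Fin 2 → ℝ) := Set.univ.pi fun k =>
    if k = i then Set.Icc ε (2 * ε) else Set.Icc (-1) 1
  have hS : MeasurableSet S := MeasurableSet.univ_pi fun k => by
    split_ifs <;> exact measurableSet_Icc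
  have hsub : foldStrip i ε ⊆ WithLp.ofLp ⁻¹' S := by
    intro p hp k _
    by_cases hk : k = i
    · subst hk; simpa using hp.1
    · simpa [hk] using abs_le.1 (hp.2 k)
  have hvol : volume (WithLp.ofLp ⁻¹' S : Set Plane) = ENNReal.ofReal (2 * ε) := by
    rw [(PiLp.volume_preserving_ofLp (Fin 2)).measure_preimage hS.nullMeasurableSet,
      volume_pi_pi, Fin.prod_univ_two]
    fin_cases i
    · simp only [Fin.zero_eta, if_true, one_ne_zero, if_false, Real.volume_Icc]
      rw [← ENNReal.ofReal_mul (by linarith)]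
      ring_nf
    · simp only [Fin.mk_one, if_true, zero_ne_one, if_false, Real.volume_Icc]
      rw [← ENNReal.ofReal_mul (by norm_num)]
      ring_nf
  refine (ENNReal.toReal_mono ENNReal.ofReal_ne_top ((measure_mono hsub).trans_eq hvol)).trans_eq ?_
  exact ENNReal.toReal_ofReal (by positivity)

theorem HasMargin.gradient_eq_zero_of_lt (h : HasMargin m φ) (hij : i ≠ j) {p : Plane}
    (hi : p i < m) (hj : p j < m) : gradient φ p = 0 := by
  have hopen : ∀ᶠ q : Plane in nhds p, q i < m ∧ q j < m :=
    (((isOpen_lt (by fun_prop : Continuous fun q : Plane => q i) continuous_const).inter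
      (isOpen_lt (by fun_prop : Continuous fun q : Plane => q j) continuous_const)).mem_nhds
      ⟨hi, hj⟩)
  have : φ =ᶠ[nhds p] fun _ => 0 := by
    filter_upwards [hopen] with q hq using h.eq_zero_of_le hij hq.1.le hq.2.le
  rw [gradient, this.fderiv_eq]
  simp

theorem HasMargin.gradient_foldPart_eq_zero (h : HasMargin m φ) (hm₀ : 0 < m)
    (hm : m ≤ 1 / 2) (hε : 0 < ε) (hεm : 2 * ε ≤ m) (hij : i ≠ j) {p : Plane} {k : Fin 2}
    (hk : 1 < |p k|) : gradient (foldPart i j ε φ) p = 0 := by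
  have : foldPart i j ε φ =ᶠ[nhds p] fun _ => 0 := by
    filter_upwards [(isOpen_lt continuous_const (by fun_prop :
      Continuous fun q : Plane => |q k|)).mem_nhds hk] with q hq
    by_contra hne
    have := (h.foldPart_ne_zero hm hε hεm hij hne).1 k
    have hq' : 1 < |q k| := hq
    linarith only [this, hq', hm₀]
  rw [gradient, this.fderiv_eq]
  simp

/-- A majorant whose terms integrate separately: the first suffices on the arms, the reflected terms
serve the positive quadrant away from the strips, and the constants cover the strips. -/
theorem HasMargin.norm_gradient_foldPart_sq_add_le_indicator (h : HasMargin m φ)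
    (hφ : ContDiff ℝ ∞ φ) (hm₀ : 0 < m) (hm : m ≤ 1 / 2) (hε : 0 < ε) (hεm : 2 * ε ≤ m)
    (hij : i ≠ j) {L G : ℝ} (hL : 1 ≤ L) (hd : ∀ t, |deriv (smoothFold ε) t| ≤ L)
    (hG : ∀ p, ‖gradient φ p‖ ^ 2 ≤ G) (p : Plane) :
    ‖gradient (foldPart i j ε φ) p‖ ^ 2 + ‖gradient (foldPart j i ε φ) p‖ ^ 2 ≤
      ‖gradient φ p‖ ^ 2 +
      {q : Plane | q i < 0}.indicator (fun q => ‖gradient φ q‖ ^ 2) (planeReflection i p) +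
      {q : Plane | q j < 0}.indicator (fun q => ‖gradient φ q‖ ^ 2) (planeReflection j p) +
      (foldStrip i ε).indicator (fun _ => 2 * (L ^ 2 * G)) p +
      (foldStrip j ε).indicator (fun _ => 2 * (L ^ 2 * G)) p := by
  have hG₀ : 0 ≤ G := (sq_nonneg _).trans (hG 0)
  have hR : ∀ k, 0 ≤ {q : Plane | q k < 0}.indicator (fun q => ‖gradient φ q‖ ^ 2)
      (planeReflection k p) := fun k => Set.indicator_nonneg (fun q _ => sq_nonneg _) _
  have hS : ∀ k, 0 ≤ (foldStrip k ε).indicator (fun _ => 2 * (L ^ 2 * G)) p := fun k =>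
    Set.indicator_nonneg (fun q _ => by positivity) _
  have hRi := hR i
  have hRj := hR j
  have hSi := hS i
  have hSj := hS j
  rcases lt_or_ge (p i) ε with hi | hi
  · rw [h.norm_gradient_foldPart_sq_add_of_lt hφ hε hεm hij hi]
    linarith
  rcases lt_or_ge (p j) ε with hj | hj
  · rw [add_comm, h.norm_gradient_foldPart_sq_add_of_lt hφ hε hεm hij.symm hj]
    linarith
  by_cases hbox : ∀ k, |p k| ≤ 1
  swap
  · push Not at hbox
    obtain ⟨k, hk⟩ := hbox
    rw [h.gradient_foldPart_eq_zero hm₀ hm hε hεm hij hk,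
      h.gradient_foldPart_eq_zero hm₀ hm hε hεm hij.symm hk]
    have := sq_nonneg ‖gradient φ p‖
    simp only [norm_zero]
    linarith
  have hcoarse := norm_gradient_foldPart_sq_add_le hφ hL (fun k => hd (p k)) i j
  have hGi := mul_le_mul_of_nonneg_left (hG (planeFold i ε p)) (sq_nonneg L)
  have hGj := mul_le_mul_of_nonneg_left (hG (planeFold j ε p)) (sq_nonneg L)
  -- On either strip both folded gradients are bounded by `L ^ 2 * G`, hence the factor 2 in the
  -- constant.
  rcases le_or_gt (p i) (2 * ε) with hi' | hi'
  · have : (foldStrip i ε).indicator (fun _ => 2 * (L ^ 2 * G)) p = 2 * (L ^ 2 * G) :=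
      Set.indicator_of_mem (show p ∈ foldStrip i ε from ⟨⟨hi, hi'⟩, hbox⟩) _
    linarith
  rcases le_or_gt (p j) (2 * ε) with hj' | hj'
  · have : (foldStrip j ε).indicator (fun _ => 2 * (L ^ 2 * G)) p = 2 * (L ^ 2 * G) :=
      Set.indicator_of_mem (show p ∈ foldStrip j ε from ⟨⟨hj, hj'⟩, hbox⟩) _
    linarith
  -- Off the strips both slopes are -1, so the estimate applies with `L = 1`.
  have hfine := norm_gradient_foldPart_sq_add_le (ε := ε) (p := p) hφ le_rfl (fun k => by
    have hk : 2 * ε < p k := by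
      have : k = i ∨ k = j := by omega
      rcases this with rfl | rfl <;> assumption
    rw [deriv_smoothFold_of_gt hε hk]; simp) i j
  have hRe : ∀ k, 2 * ε < p k →
      {q : Plane | q k < 0}.indicator (fun q => ‖gradient φ q‖ ^ 2) (planeReflection k p) =
        ‖gradient φ (planeFold k ε p)‖ ^ 2 := by
    intro k hk
    rw [planeFold_of_ge hε hk.le]
    refine Set.indicator_of_mem (s := {q : Plane | q k < 0})
      (show planeReflection k p k < 0 from ?_) _
    rw [planeReflection_apply_same]
    linarith
  rw [hRe i hi', hRe j hj']
  linarith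

theorem integrable_norm_gradient_sq {U : Set Plane} (hφ : IsTestFunction U φ) :
    Integrable fun p => ‖gradient φ p‖ ^ 2 :=
  (hφ.memLp_gradient volume).integrable_norm_pow (by norm_num)

theorem exists_norm_gradient_sq_le {U : Set Plane} (hφ : IsTestFunction U φ) :
    ∃ G, ∀ p, ‖gradient φ p‖ ^ 2 ≤ G := by
  have hc : Continuous (gradient φ) :=
    (LinearIsometryEquiv.continuous _).comp (hφ.1.continuous_fderiv (by simp))
  have hs : HasCompactSupport (gradient φ) := (hφ.2.1.fderiv ℝ).comp_left (map_zero _)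
  obtain ⟨C, hC⟩ := hs.exists_bound_of_continuous hc
  exact ⟨C ^ 2, fun p => pow_le_pow_left₀ (norm_nonneg _) (hC p) 2⟩

/-- The two parts of a test function on the L-shaped domain have, up to an arbitrarily small
error, at most twice its energy. -/
theorem exists_foldPart_energy_le (hφ : IsTestFunction lShape φ) {η : ℝ} (hη : 0 < η) :
    ∃ ε, IsTestFunction lRect₁ (foldPart 0 1 ε φ) ∧ IsTestFunction lRect₂ (foldPart 1 0 ε φ) ∧
      (∫ p, ‖gradient (foldPart 0 1 ε φ) p‖ ^ 2) + ∫ p, ‖gradient (foldPart 1 0 ε φ) p‖ ^ 2 ≤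
        2 * (∫ p, ‖gradient φ p‖ ^ 2) + η := by
  obtain ⟨m, hm₀, hm, h⟩ := exists_hasMargin hφ
  obtain ⟨L, hL, hd⟩ := exists_abs_deriv_smoothFold_le
  obtain ⟨G, hG⟩ := exists_norm_gradient_sq_le hφ
  have hG₀ : 0 ≤ G := (sq_nonneg _).trans (hG 0)
  set M : ℝ := 2 * (L ^ 2 * G) with hM
  have hM₀ : 0 ≤ M := by positivity
  -- The first bound keeps the folds within the margin. The second makes the two strips, of area at
  -- most `2 * ε` each, cost at most `η`; `M + 1` avoids dividing by zero.
  set ε : ℝ := min (m / 2) (η / (4 * (M + 1))) with hεdef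
  have hε : 0 < ε := by positivity
  have hεm : 2 * ε ≤ m := by linarith [min_le_left (m / 2) (η / (4 * (M + 1)))]
  have hεη : 4 * ε * M ≤ η := by
    have h₁ : ε ≤ η / (4 * (M + 1)) := min_le_right _ _
    rw [le_div_iff₀ (by positivity)] at h₁
    nlinarith
  have t₁ := h.isTestFunction_foldPart hφ.1 hm₀ hm hε hεm (i := 0) (j := 1) (by decide)
  have t₂ := h.isTestFunction_foldPart hφ.1 hm₀ hm hε hεm (i := 1) (j := 0) (by decide)
  have hswap : {p : Plane | p 1 ∈ Set.Ioo (-1) 1 ∧ p 0 ∈ Set.Ioo 0 1} = lRect₂ := by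
    ext p; exact and_comm
  refine ⟨ε, t₁, hswap ▸ t₂, ?_⟩
  set g : Plane → ℝ := fun p => ‖gradient φ p‖ ^ 2 with hg
  have hgi : Integrable g := integrable_norm_gradient_sq hφ
  let N : Fin 2 → Set Plane := fun k => {q | q k < 0}
  have hN : ∀ k, MeasurableSet (N k) := fun k =>
    (isOpen_lt (by fun_prop : Continuous fun q : Plane => q k) continuous_const).measurableSet
  have hNi : ∀ k, Integrable ((N k).indicator g) := fun k => hgi.indicator (hN k)
  have hmp : ∀ k, MeasurePreserving (planeReflection k) := fun k =>
    (planeReflection k).measurePreserving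
  have hRi : ∀ k, Integrable fun p => (N k).indicator g (planeReflection k p) := fun k =>
    (hmp k).integrable_comp_of_integrable (hNi k)
  have hRint : ∀ k, ∫ p, (N k).indicator g (planeReflection k p) = ∫ p, (N k).indicator g p :=
    fun k => (hmp k).integral_comp (planeReflection k).toHomeomorph.measurableEmbedding _
  have hSi : ∀ k, Integrable ((foldStrip k ε).indicator fun _ => M) := fun k =>
    (integrable_indicator_iff (isClosed_foldStrip k ε).measurableSet).2
      (integrableOn_const (volume_foldStrip_ne_top k ε))
  have hSint : ∀ k, ∫ p, (foldStrip k ε).indicator (fun _ => M) p ≤ 2 * ε * M := fun k => by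
    rw [integral_indicator (isClosed_foldStrip k ε).measurableSet, setIntegral_const, smul_eq_mul]
    exact mul_le_mul_of_nonneg_right (volume_real_foldStrip_le k hε) hM₀
  -- The two half-planes overlap only where `φ` is locally zero, so no energy is counted twice.
  have hNN : (∫ p, (N 0).indicator g p) + ∫ p, (N 1).indicator g p ≤ ∫ p, g p := by
    rw [← integral_add (hNi 0) (hNi 1)]
    refine integral_mono ((hNi 0).add (hNi 1)) hgi fun p => ?_
    have hgp : 0 ≤ g p := sq_nonneg _
    by_cases h₀ : p ∈ N 0
    · by_cases h₁ : p ∈ N 1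
      · have : g p = 0 := by
          simp only [hg]
          rw [h.gradient_eq_zero_of_lt (i := 0) (j := 1) (by decide) (lt_trans h₀ hm₀)
            (lt_trans h₁ hm₀)]
          simp
        simp [h₀, h₁, this]
      · simp [h₀, h₁]
    · by_cases h₁ : p ∈ N 1
      · simp [h₀, h₁]
      · simpa [h₀, h₁] using hgp
  rw [← integral_add (integrable_norm_gradient_sq t₁) (integrable_norm_gradient_sq t₂)]
  have i₁ := hgi.add (hRi 0)
  have i₂ := i₁.add (hRi 1)
  have i₃ := i₂.add (hSi 0)
  have hmono := integral_mono ((integrable_norm_gradient_sq t₁).add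
    (integrable_norm_gradient_sq t₂)) (i₃.add (hSi 1)) fun p =>
      h.norm_gradient_foldPart_sq_add_le_indicator hφ.1 hm₀ hm hε hεm (i := 0) (j := 1)
        (by decide) hL (hd ε hε) hG p
  rw [integral_add' i₃ (hSi 1), integral_add' i₂ (hSi 0), integral_add' i₁ (hRi 1),
    integral_add' hgi (hRi 0), hRint, hRint] at hmono
  have hS₀ := hSint 0
  have hS₁ := hSint 1
  refine hmono.trans ?_
  linarith

/-! ### Decomposition of the smooth elements of `H¹₀` -/

theorem gradient_foldPart_add_gradient_foldPart (hφ : ContDiff ℝ ∞ φ) (i j : Fin 2) (ε : ℝ)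
    (p : Plane) :
    gradient (foldPart i j ε φ) p + gradient (foldPart j i ε φ) p = gradient φ p := by
  rw [gradient_foldPart hφ, gradient_foldPart hφ]
  module

theorem lRect₁_subset_lShape : lRect₁ ⊆ lShape := fun _ hp =>
  ⟨⟨hp.1, by linarith [hp.2.1], hp.2.2⟩, fun h => not_lt.2 h.2.2 hp.2.1⟩

theorem lRect₂_subset_lShape : lRect₂ ⊆ lShape := fun _ hp =>
  ⟨⟨⟨by linarith [hp.1.1], hp.1.2⟩, hp.2⟩, fun h => not_lt.2 h.1.2 hp.1.1⟩

theorem exists_decompositionCosts_le_of_mem_testSubspace {C : ℝ} (hC : √2 < C) {v : H10 lShape}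
    (hv : v ∈ (testSubspace lShape lShape).comap H10.toH1) :
    ∃ r ∈ decompositionCosts ![H10Sub lShape lRect₁, H10Sub lShape lRect₂] v, r ≤ C * ‖v‖ := by
  -- The zero vector is separated because the error allowed below must be strictly positive.
  rcases eq_or_ne v 0 with rfl | hv₀
  · refine ⟨0, ⟨0, fun i => Submodule.zero_mem _, by simp, by simp⟩, ?_⟩
    rw [norm_zero, mul_zero]
  have hC₀ : 0 < C := (Real.sqrt_nonneg 2).trans_lt hC
  have hC2 : 2 < C ^ 2 := by
    have := Real.sq_sqrt (show (0 : ℝ) ≤ 2 by norm_num)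
    nlinarith [Real.sqrt_nonneg 2]
  have hvn : 0 < ‖v‖ := norm_pos_iff.2 hv₀
  obtain ⟨φ, hφ, -, hgrad⟩ := hv
  have hvint : ‖v‖ ^ 2 = ∫ p, ‖gradient φ p‖ ^ 2 := H10.norm_sq_eq_integral hφ hgrad
  -- This `η` turns `2 * ‖v‖ ^ 2 + η` into `C ^ 2 * ‖v‖ ^ 2`.
  obtain ⟨ε, t₁, t₂, hle⟩ := exists_foldPart_energy_le hφ (η := (C ^ 2 - 2) * ‖v‖ ^ 2)
    (mul_pos (by linarith) (by positivity))
  have s₁ := t₁.mono lRect₁_subset_lShape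
  have s₂ := t₂.mono lRect₂_subset_lShape
  refine ⟨_, ⟨![s₁.toH10, s₂.toH10], ?_, ?_, rfl⟩, ?_⟩
  · intro k
    fin_cases k
    · exact s₁.toH10_mem_H10Sub t₁
    · exact s₂.toH10_mem_H10Sub t₂
  · rw [Fin.sum_univ_two]
    -- By Poincaré, equality in `H¹₀` may be tested on gradients alone.
    refine H10.grad_injective ?_
    change H10.grad v = H10.grad (s₁.toH10 + s₂.toH10)
    rw [map_add]
    refine Lp.ext ?_
    filter_upwards [hgrad, s₁.grad_toH10_ae_eq, s₂.grad_toH10_ae_eq,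
      Lp.coeFn_add (H10.grad s₁.toH10) (H10.grad s₂.toH10)] with p h h₁ h₂ h₃
    rw [h₃, Pi.add_apply, h₁, h₂, gradient_foldPart_add_gradient_foldPart hφ.1]
    exact h
  · rw [Fin.sum_univ_two]
    refine Real.sqrt_le_iff.2 ⟨by positivity, ?_⟩
    change ‖s₁.toH10‖ ^ 2 + ‖s₂.toH10‖ ^ 2 ≤ _
    rw [s₁.norm_toH10_sq, s₂.norm_toH10_sq, mul_pow]
    rw [← hvint] at hle
    linarith

end Energy

theorem mainTheorem3 :
    (∀ v : H10 lShape, ∃ r : ℝ,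
      IsLeast (decompositionCosts ![H10Sub lShape lRect₁, H10Sub lShape lRect₂] v) r) ∧
    decompositionConstant ![H10Sub lShape lRect₁, H10Sub lShape lRect₂] ≤
      ENNReal.ofReal (√2) := by
  refine decompositionConstant_le_of_dense (fun k => ?_) dense_testSubspace (by positivity)
    fun C hC v hv => exists_decompositionCosts_le_of_mem_testSubspace hC hv
  fin_cases k
  · exact isClosed_H10Sub lRect₁
  · exact isClosed_H10Sub lRect₂
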